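/- All graphs are finite and simple. A graph is $K_{1,m}$-free if it has no induced subgraph isomorphic to the star $K_{1,m}$. For a set $W$ of an even number of vertices of a graph $G$, a spanning path-cycle system with respect to $W$ is a collection of pairwise vertex-disjoint paths $P_1,\dots,P_m$ and cycles $C_1,\dots,C_n$ of $G$ ($m,n\ge 0$) such that each $P_i$ connects two distinct vertices of $W$, the set of end-vertices of the $P_i$'s is equal to $W$, and $V(G)=V(P_1)\cup\dots\cup V(P_m)\cup V(C_1)\cup\dots\cup V(C_n)$. Let $r\ge 4$ be an integer. In the following statements $W$ denotes a set of an even number of vertices of $G$ such that the distance in $G$ between any two distinct vertices of $W$ is at least $3$, and "infinitely many pairs" means infinitely many pairs whose graphs are pairwise non-isomorphic. (1) If $r$ is odd, then there are infinitely many pairs $(G,W)$ of a $K_{1,r}$-free, $(r-1)$-edge-connected, $r$-regular graph $G$ and $W\subseteq V(G)$ such that $G$ has no spanning path-cycle system with respect to $W$. (2) If $r$ is even, then there are infinitely many pairs $(G,W)$ of a $K_{1,r}$-free, $(r-2)$-edge-connected, $r$-regular graph $G$ and $W\subseteq V(G)$ such that $G$ has no spanning path-cycle system with respect to $W$. (3)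 For every $r$, there are infinitely many pairs $(G,W)$ of an $r$-edge-connected, $r$-regular, bipartite graph $G$ and $W\subseteq V(G)$ such that $G$ has no spanning path-cycle system with respect to $W$. -/

import Mathlib

/-- The star `K_{1,m}`: the complete bipartite graph with partite sets of sizes `1` and `m`. -/
abbrev starK1 (m : ℕ) : SimpleGraph (Fin 1 ⊕ Fin m) :=
  completeBipartiteGraph (Fin 1) (Fin m)

/-- `G` is `K_{1,m}`-free: no induced subgraph of `G` is isomorphic to `K_{1,m}`. -/
def StarFree {V : Type*} (m : ℕ) (G : SimpleGraph V) : Prop :=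
  ¬ (starK1 m).IsIndContained G

open Classical in
/-- `G` is an `r`-regular (finite) graph. -/
def IsRegularGraph {V : Type*} [Fintype V] (r : ℕ) (G : SimpleGraph V) : Prop :=
  G.IsRegularOfDegree r

/-- `G` has a spanning path-cycle system with respect to `W`: pairwise vertex-disjoint paths
`P i`, each joining two distinct vertices `a i`, `b i` of `W`, and cycles `C j`, such that the set
of the end-vertices of the paths is `W` and every vertex of `G` lies on one of the paths or
cycles. -/
def HasSpanningPathCycleSystem {V : Type*} (G : SimpleGraph V) (W : Set V) : Prop :=
  ∃ (m n : ℕ) (a b : Fin m → V) (P : ∀ i, G.Walk (a i) (b i))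
    (c : Fin n → V) (C : ∀ j, G.Walk (c j) (c j)),
    (∀ i, (P i).IsPath) ∧
    (∀ j, (C j).IsCycle) ∧
    (∀ i i', i ≠ i' → (P i).support.Disjoint (P i').support) ∧
    (∀ j j', j ≠ j' → (C j).support.Disjoint (C j').support) ∧
    (∀ i j, (P i).support.Disjoint (C j).support) ∧
    (∀ i, a i ∈ W ∧ b i ∈ W ∧ a i ≠ b i) ∧
    {v | ∃ i, v = a i ∨ v = b i} = W ∧
    (∀ v, (∃ i, v ∈ (P i).support) ∨ (∃ j, v ∈ (C j).support))

/-- A pair `(G, W)` of a finite simple graph `G` (up to isomorphism, with vertex set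
`{0, …, order - 1}`) and a set `W` of vertices of `G`. -/
structure GraphPair where
  order : ℕ
  G : SimpleGraph (Fin order)
  W : Finset (Fin order)

/-- `W` consists of an even number of vertices, any two of which are at distance at least `3` in
`G`. -/
def GraphPair.EvenAndFarApart (p : GraphPair) : Prop :=
  Even p.W.card ∧ ∀ u ∈ p.W, ∀ v ∈ p.W, u ≠ v → 3 ≤ p.G.edist u v

/-- Infinitely many pairs `(G, W)` have the property `Q`, in the strong sense that there are
infinitely many of them whose graphs are pairwise non-isomorphic. -/
def InfinitelyManyPairs (Q : GraphPair → Prop) : Prop :=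
  ∃ F : ℕ → GraphPair,
    (∀ i, Q (F i)) ∧ ∀ i j, i ≠ j → IsEmpty ((F i).G ≃g (F j).G)

/-!
The bipartite pairs come from balance. If `G` is bipartite with sides of equal size and `W` lies in
one side, then every path of a spanning path-cycle system covers one more vertex of that side than
of the other and every cycle covers equally many of both, so there are no paths, which is absurd for
nonempty `W` (`not_hasSpanningPathCycleSystem_of_balanced`). Large `r`-regular, `r`-edge-connected
bipartite graphs are obtained from long even cycles by taking prisms, each of which raises the degree
and the edge connectivity by one (`SimpleGraph.IsEdgeConnected.prism`).

The star-free pairs come from a separator. If `S ⊆ W` and every component of `G - S` contains at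
most one vertex of `W`, then every path of a spanning path-cycle system has an end in `S`, because it
cannot pass through a vertex of `S`; so `|W| ≤ 2 |S|`
(`not_hasSpanningPathCycleSystem_of_separator`). The components of `G - S` are copies of one *plug*
(`IsPlug`), a graph with `2ρ` ports of degree `r - 1`, all other degrees being `r`, that is itself
`2ρ`-edge-connected; here `2ρ` is the even one of `r - 1` and `r - 2`. Each vertex of `S` is joined
to `r` ports. Counting the edges between them gives `r |S| = 2ρ q` for `q` plugs, so `q > |S|`; a
vertex of `W` far from the ports in each of `|S| + 2` plugs completes `W`. An `r`-regular graph is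
`K_{1,r}`-free as soon as every vertex lies in a triangle (`starFree_of_forall_triangle`), and a
vertex of `S` does if two of its ports are in the same plug, the ports being pairwise adjacent.

Edge connectivity is always shown in the same way: a vertex that has `k` pairwise edge-disjoint
routes to a set connected after the deletion of fewer than `k` edges is joined to that set by a
surviving route (`exists_forall_notMem_of_encard_lt`). The pattern by which `S` is joined to the plugs
(`joiningPattern`) is chosen so that such routes are short. Infinitely many graphs arise because plugs
can be arbitrarily large (`exists_isPlug`).
-/

/-! ### Infinite families of pairs -/

theorem InfinitelyManyPairs.of_forall_exists_order_gt {Q : GraphPair → Prop}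
    (h : ∀ n, ∃ p : GraphPair, Q p ∧ n < p.order) : InfinitelyManyPairs Q := by
  choose f hf hlt using h
  let F : ℕ → GraphPair := fun i => Nat.rec (f 0) (fun _ p => f p.order) i
  have hmono : StrictMono fun i => (F i).order := strictMono_nat_of_lt_succ fun i => hlt _
  refine ⟨F, fun i => ?_, fun i j hij => ⟨fun e => hij (hmono.injective ?_)⟩⟩
  · cases i with
    | zero => exact hf 0
    | succ i => exact hf _
  · simpa using Fintype.card_congr e.toEquiv

/-- The pair `(G, W)` with the vertices of `G` renamed to `0, …, |V| - 1`. -/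
noncomputable def GraphPair.ofGraph {V : Type*} [Fintype V] (G : SimpleGraph V) (W : Finset V) :
    GraphPair where
  order := Fintype.card V
  G := G.overFin rfl
  W := W.map (G.overFinIso rfl).toEquiv.toEmbedding

section Transfer

variable {V V' : Type*} {G : SimpleGraph V} {G' : SimpleGraph V'}

theorem StarFree.of_iso {m : ℕ} (e : G ≃g G') (h : StarFree m G) : StarFree m G' :=
  fun ⟨f⟩ => h ⟨e.symm.toEmbedding.comp f⟩

/-- Deleting fewer than `k` edges from `G'` leaves every copy of a `k`-edge-connected graph in `G'`
connected. -/
theorem SimpleGraph.IsEdgeConnected.reachable_map {k : ℕ} (h : G.IsEdgeConnected k) (φ : G →g G')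
    (hφ : Function.Injective φ) {D : Set (Sym2 V')} (hD : D.encard < k) (u v : V) :
    (G'.deleteEdges D).Reachable (φ u) (φ v) := by
  have hinj : Function.Injective (Sym2.map φ) := Sym2.map.injective hφ
  have h1 : (Sym2.map φ ⁻¹' D).encard < k := by
    refine lt_of_le_of_lt ?_ hD
    rw [← hinj.encard_image]
    exact Set.encard_le_encard (Set.image_preimage_subset _ _)
  let ψ : G.deleteEdges (Sym2.map φ ⁻¹' D) →g G'.deleteEdges D :=
    { toFun := φ
      map_rel' := fun {a b} hab => by
        rw [SimpleGraph.deleteEdges_adj] at hab ⊢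
        exact ⟨φ.map_adj hab.1, hab.2⟩ }
  exact (h u v h1).map ψ

theorem SimpleGraph.IsEdgeConnected.of_iso {k : ℕ} (e : G ≃g G') (h : G.IsEdgeConnected k) :
    G'.IsEdgeConnected k := by
  intro u v D hD
  simpa using h.reachable_map e.toHom e.injective hD (e.symm u) (e.symm v)

theorem HasSpanningPathCycleSystem.map_iso (e : G ≃g G') {W : Set V}
    (h : HasSpanningPathCycleSystem G W) : HasSpanningPathCycleSystem G' (e '' W) := by
  obtain ⟨m, n, a, b, P, c, C, hP, hC, hPP, hCC, hPC, hab, hW, hcov⟩ := h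
  have hdisj : ∀ {l l' : List V}, l.Disjoint l' → (l.map e).Disjoint (l'.map e) :=
    fun {l l'} hl => List.disjoint_map e.injective hl
  refine ⟨m, n, fun i => e (a i), fun i => e (b i), fun i => (P i).map e.toHom,
    fun j => e (c j), fun j => (C j).map e.toHom,
    fun i => (SimpleGraph.Walk.isPath_map_iff_of_injective e.injective).2 (hP i),
    fun j => (hC j).map e.injective, fun i i' hii => ?_, fun j j' hjj => ?_, fun i j => ?_,
    fun i => ?_, ?_, fun v => ?_⟩
  · rw [SimpleGraph.Walk.support_map, SimpleGraph.Walk.support_map]; exact hdisj (hPP i i' hii)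
  · rw [SimpleGraph.Walk.support_map, SimpleGraph.Walk.support_map]; exact hdisj (hCC j j' hjj)
  · rw [SimpleGraph.Walk.support_map, SimpleGraph.Walk.support_map]; exact hdisj (hPC i j)
  · exact ⟨⟨_, (hab i).1, rfl⟩, ⟨_, (hab i).2.1, rfl⟩, fun h => (hab i).2.2 (e.injective h)⟩
  · rw [← hW]
    ext v
    simp only [Set.mem_ofPred_eq, Set.mem_image]
    constructor
    · rintro ⟨i, rfl | rfl⟩
      exacts [⟨_, ⟨i, .inl rfl⟩, rfl⟩, ⟨_, ⟨i, .inr rfl⟩, rfl⟩]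
    · rintro ⟨_, ⟨i, rfl | rfl⟩, rfl⟩
      exacts [⟨i, .inl rfl⟩, ⟨i, .inr rfl⟩]
  · obtain ⟨w, rfl⟩ := e.surjective v
    simp only [SimpleGraph.Walk.support_map, List.mem_map]
    rcases hcov w with ⟨i, hi⟩ | ⟨j, hj⟩
    exacts [.inl ⟨i, w, hi, rfl⟩, .inr ⟨j, w, hj, rfl⟩]

theorem isRegularGraph_of_ncard [Fintype V] {r : ℕ} (h : ∀ v, (G.neighborSet v).ncard = r) :
    IsRegularGraph r G := by
  classical
  intro v
  rw [← h v, Set.ncard_eq_toFinset_card', SimpleGraph.degree, SimpleGraph.neighborFinset]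

theorem IsRegularGraph.of_iso [Fintype V] [Fintype V'] {r : ℕ} (e : G ≃g G')
    (h : IsRegularGraph r G) : IsRegularGraph r G' := by
  classical
  refine isRegularGraph_of_ncard fun v => ?_
  have h1 : (G.neighborSet (e.symm v)).ncard = r := by
    rw [← h (e.symm v), Set.ncard_eq_toFinset_card', SimpleGraph.degree,
      SimpleGraph.neighborFinset]
  rw [← h1]
  exact (Set.ncard_congr' (e.symm.mapNeighborSet v))

end Transfer

/-- Distance at least three is the absence of walks of length at most two. -/
theorem SimpleGraph.three_le_edist_iff {V : Type*} {G : SimpleGraph V} {u v : V} :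
    3 ≤ G.edist u v ↔ u ≠ v ∧ ¬ G.Adj u v ∧ ∀ x, G.Adj u x → ¬ G.Adj v x := by
  have h : (3 : ℕ∞) ≤ G.edist u v ↔ 2 < G.edist u v := by
    rw [show (3 : ℕ∞) = 2 + 1 from rfl]
    exact ENat.add_one_le_iff (by decide)
  rw [h, SimpleGraph.two_lt_edist_iff, Set.eq_empty_iff_forall_notMem]
  simp [SimpleGraph.mem_commonNeighbors]

theorem GraphPair.evenAndFarApart_ofGraph {V : Type*} [Fintype V] {G : SimpleGraph V}
    {W : Finset V} (hW : Even W.card)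
    (hfar : ∀ u ∈ W, ∀ v ∈ W, u ≠ v → ¬ G.Adj u v ∧ ∀ x, G.Adj u x → ¬ G.Adj v x) :
    (GraphPair.ofGraph G W).EvenAndFarApart := by
  refine ⟨by simpa [ofGraph] using hW, ?_⟩
  intro u hu v hv huv
  obtain ⟨u, hu', rfl⟩ := Finset.mem_map.1 hu
  obtain ⟨v, hv', rfl⟩ := Finset.mem_map.1 hv
  have huv' : u ≠ v := fun h => huv (by rw [h])
  obtain ⟨h1, h2⟩ := hfar u hu' v hv' huv'
  refine SimpleGraph.three_le_edist_iff.2 ⟨huv, fun h => h1 ?_, fun x hux hvx => ?_⟩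
  · exact (G.overFinIso rfl).map_adj_iff.1 h
  · obtain ⟨x, rfl⟩ := (G.overFinIso rfl).surjective x
    exact h2 x ((G.overFinIso rfl).map_adj_iff.1 hux) ((G.overFinIso rfl).map_adj_iff.1 hvx)

theorem GraphPair.not_hasSpanningPathCycleSystem_ofGraph {V : Type*} [Fintype V]
    {G : SimpleGraph V} {W : Finset V} (h : ¬ HasSpanningPathCycleSystem G (W : Set V)) :
    ¬ HasSpanningPathCycleSystem (GraphPair.ofGraph G W).G
      ((GraphPair.ofGraph G W).W : Set (Fin (GraphPair.ofGraph G W).order)) := by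
  intro hs
  apply h
  have := HasSpanningPathCycleSystem.map_iso (G.overFinIso rfl).symm hs
  convert this using 1
  ext v
  constructor
  · exact fun hv => ⟨G.overFinIso rfl v, Finset.mem_coe.2 (Finset.mem_map_of_mem _ hv),
      (G.overFinIso rfl).symm_apply_apply v⟩
  · rintro ⟨_, hw, rfl⟩
    obtain ⟨w, hw', rfl⟩ := Finset.mem_map.1 (Finset.mem_coe.1 hw)
    exact (congrArg (· ∈ W) ((G.overFinIso rfl).symm_apply_apply w)).mpr hw'

/-! ### Sets of deleted edges and edge connectivity -/

/-- Among `k` pairwise disjoint sets of edges, one avoids any given set of fewer than `k` edges. -/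
theorem exists_forall_notMem_of_encard_lt {ι α : Type*} [Finite ι] {k : ℕ} (hk : k ≤ Nat.card ι)
    {D : Set α} (hD : D.encard < k) (F : ι → Set α)
    (hF : ∀ i j e, e ∈ F i → e ∈ F j → i = j) : ∃ i, ∀ e ∈ F i, e ∉ D := by
  by_contra! h
  choose g hgF hgD using h
  have hinj : Function.Injective g := fun i j hij => hF i j (g i) (hgF i) (hij ▸ hgF j)
  have h1 : (Set.range g).encard ≤ D.encard :=
    Set.encard_le_encard (Set.range_subset_iff.2 hgD)
  rw [← Set.image_univ, hinj.encard_image, Set.encard_univ, ENat.card_eq_coe_natCard] at h1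
  have h2 : (Nat.card ι : ℕ∞) < k := h1.trans_lt hD
  exact absurd (ENat.natCast_lt_natCast.1 h2) (not_lt.2 hk)

namespace SimpleGraph

/-- The prism over a `k`-edge-connected graph with more than `k` vertices is
`(k + 1)`-edge-connected. -/
theorem IsEdgeConnected.prism {V : Type*} [Finite V] {G : SimpleGraph V} {k : ℕ} (hk : 0 < k)
    (hG : G.IsEdgeConnected k) (hcard : k < Nat.card V) :
    (G □ (⊤ : SimpleGraph Bool)).IsEdgeConnected (k + 1) := by
  intro x y D hD
  set H := (G □ (⊤ : SimpleGraph Bool)).deleteEdges D with hH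
  let ι : Bool → Sym2 V → Sym2 (V × Bool) := fun b => Sym2.map (·, b)
  have hι : ∀ b, Function.Injective (ι b) := fun b =>
    Sym2.map.injective (Prod.mk_left_injective b)
  have hlayer : ∀ b, (ι b ⁻¹' D).encard < k → ∀ u v, H.Reachable (u, b) (v, b) := by
    intro b hb u v
    let φ : G.deleteEdges (ι b ⁻¹' D) →g H :=
      { toFun := (·, b)
        map_rel' := fun {p q} hpq => by
          rw [deleteEdges_adj] at hpq
          rw [hH, deleteEdges_adj]
          exact ⟨boxProd_adj_left.2 hpq.1, hpq.2⟩ }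
    exact (hG u v hb).map φ
  have hrung : ∀ v b, s((v, b), (v, !b)) ∉ D → H.Reachable (v, b) (v, !b) := by
    intro v b hv
    refine Adj.reachable ?_
    rw [hH, deleteEdges_adj]
    exact ⟨boxProd_adj_right.2 (by cases b <;> simp), hv⟩
  by_cases hall : ∀ b, (ι b ⁻¹' D).encard < k
  · obtain ⟨w, hw⟩ := exists_forall_notMem_of_encard_lt (k := k + 1) hcard (by exact_mod_cast hD)
      (fun v : V => {s((v, false), (v, true))}) (by
        rintro i j e rfl h
        simpa using h)
    have hw' : H.Reachable (w, false) (w, true) := hrung w false (hw _ rfl)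
    have key : ∀ z : V × Bool, H.Reachable z (w, false) := by
      rintro ⟨v, b⟩
      cases b
      · exact hlayer _ (hall _) _ _
      · exact (hlayer _ (hall _) _ _).trans hw'.symm
    exact (key x).trans (key y).symm
  · -- All `k` deleted edges lie in one layer: the other layer and the rungs are intact.
    push Not at hall
    obtain ⟨b, hb⟩ := hall
    have hDk : D.encard ≤ k := by
      have : D.encard < (k : ℕ∞) + 1 := by exact_mod_cast hD
      exact ENat.lt_natCast_add_one_iff.1 this
    have himg : ι b '' (ι b ⁻¹' D) = D := by
      have hfin : D.Finite := Set.finite_of_encard_le_coe hDk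
      refine Set.Finite.eq_of_subset_of_encard_le' hfin (Set.image_preimage_subset _ _) ?_
      rw [(hι b).encard_image]
      exact hDk.trans hb
    have hmem : ∀ e ∈ D, ∀ z ∈ e, z.2 = b := by
      intro e he z hz
      rw [← himg] at he
      obtain ⟨e, -, rfl⟩ := he
      obtain ⟨v, -, rfl⟩ := Sym2.mem_map.1 hz
      rfl
    have hother : ι (!b) ⁻¹' D = ∅ := by
      rw [Set.eq_empty_iff_forall_notMem]
      intro e he
      induction e with
      | _ u v =>
        have := hmem _ he (u, !b) (by simp [ι])
        simp at this
    have key : ∀ z w : V × Bool, w.2 = !b → H.Reachable z w := by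
      rintro ⟨u, c⟩ ⟨w, d⟩ hw
      obtain rfl : d = !b := hw
      have hlay := hlayer (!b) (by rw [hother]; simpa using hk)
      by_cases hc : c = b
      · subst hc
        refine (hrung u c fun h => ?_).trans (hlay u w)
        have := hmem _ h (u, !c) (by simp)
        simp at this
      · obtain rfl : c = !b := by cases b <;> cases c <;> simp_all
        exact hlay u w
    exact (key x (y.1, !b) rfl).trans (key y (y.1, !b) rfl).symm

theorem isEdgeConnected_two_cycleGraph (n : ℕ) : (cycleGraph (n + 3)).IsEdgeConnected 2 := by
  have hmem : ∀ v, v ∈ (cycleGraph.cycle n).support := by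
    intro v
    have h := cycleGraph.getVert_cycle (n := n) (m := n + 3 - v.val) (by omega)
    have h2 : (cycleGraph.cycle n).getVert (n + 3 - v.val) = v := by
      rw [h]
      ext
      have := v.isLt
      simp only
      rw [show n + 3 - (n + 3 - v.val) = v.val by omega, Nat.mod_eq_of_lt this]
    rw [← h2]
    exact Walk.getVert_mem_support _ _
  exact fun u v => cycleGraph.isCycle_cycle.isTrail.isEdgeReachable_two (hmem u) (hmem v)

end SimpleGraph

/-! ### Bipartite graphs -/

/-- Twice the sum over a walk of a function that changes sign along every edge telescopes. -/
theorem SimpleGraph.Walk.two_mul_sum_support_of_alternating {V : Type*} {G : SimpleGraph V}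
    {f : V → ℤ} (hf : ∀ u v, G.Adj u v → f v = - f u) {u v : V} (p : G.Walk u v) :
    2 * (p.support.map f).sum = f u + f v := by
  induction p with
  | nil => simp [two_mul]
  | cons h p ih =>
    rw [SimpleGraph.Walk.support_cons, List.map_cons, List.sum_cons, mul_add, ih, hf _ _ h]
    ring

/-- Let `f` change sign along every edge, have total sum zero and equal `1` on `W`, as the indicator
`±1` of the sides of a balanced bipartition does if `W` lies on one side. A path with both ends in
`W` has `f`-sum `1` and a cycle has `f`-sum `0`, so no path can occur in a spanning system. -/
theorem not_hasSpanningPathCycleSystem_of_balanced {V : Type*} [Fintype V] {G : SimpleGraph V}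
    {f : V → ℤ} (hf : ∀ u v, G.Adj u v → f v = - f u) (hsum : ∑ v, f v = 0) {W : Set V}
    (hne : W.Nonempty) (hW : ∀ v ∈ W, f v = 1) : ¬ HasSpanningPathCycleSystem G W := by
  classical
  rintro ⟨m, n, a, b, P, c, C, hP, hC, hPP, hCC, hPC, hab, hWeq, hcov⟩
  -- The first vertex of a cycle is repeated at the end of its support: only the tail counts.
  let T : Fin m ⊕ Fin n → Finset V :=
    Sum.elim (fun i => (P i).support.toFinset) (fun j => (C j).support.tail.toFinset)
  have htail : ∀ j v, v ∈ (C j).support → v ∈ (C j).support.tail := by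
    intro j v hv
    rcases (SimpleGraph.Walk.mem_support_iff _).1 hv with rfl | h
    · exact SimpleGraph.Walk.end_mem_tail_support (hC j).not_nil
    · exact h
  have hcover : (Finset.univ : Finset V) = Finset.univ.biUnion T := by
    ext v
    simp only [Finset.mem_univ, Finset.mem_biUnion, true_and, true_iff]
    rcases hcov v with ⟨i, hi⟩ | ⟨j, hj⟩
    · exact ⟨.inl i, by simpa [T] using hi⟩
    · exact ⟨.inr j, by simpa [T] using htail j v hj⟩
  have hdisj : (Set.univ : Set (Fin m ⊕ Fin n)).PairwiseDisjoint T := by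
    have hmt : ∀ j v, v ∈ (C j).support.tail → v ∈ (C j).support :=
      fun j v hv => List.mem_of_mem_tail hv
    rintro (i | i) - (j | j) - hij <;> refine Finset.disjoint_left.2 fun v hv hv' => ?_ <;>
      simp only [T, Sum.elim_inl, Sum.elim_inr, List.mem_toFinset] at hv hv'
    · exact hPP i j (fun h => hij (by rw [h])) hv hv'
    · exact hPC i j hv (hmt _ _ hv')
    · exact hPC j i hv' (hmt _ _ hv)
    · exact hCC i j (fun h => hij (by rw [h])) (hmt _ _ hv) (hmt _ _ hv')
  have hsumT : ∀ t, ∑ v ∈ T t, f v = Sum.elim (fun _ => 1) (fun _ => 0) t := by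
    rintro (i | j)
    · have h := (P i).two_mul_sum_support_of_alternating hf
      rw [hW _ (hab i).1, hW _ (hab i).2.1] at h
      simp only [T, Sum.elim_inl]
      rw [List.sum_toFinset _ (hP i).support_nodup]
      linarith
    · have h := (C j).two_mul_sum_support_of_alternating hf
      rw [← SimpleGraph.Walk.cons_tail_support, List.map_cons, List.sum_cons] at h
      simp only [T, Sum.elim_inr]
      rw [List.sum_toFinset _ (hC j).support_nodup]
      linarith
  rw [hcover, Finset.sum_biUnion (by simpa using hdisj), Finset.sum_congr rfl fun t _ => hsumT t,
    Fintype.sum_sum_type] at hsum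
  simp only [Sum.elim_inl, Sum.elim_inr, Finset.sum_const, Finset.card_univ, Fintype.card_fin,
    smul_zero, add_zero, nsmul_eq_mul, mul_one, Nat.cast_eq_zero] at hsum
  subst hsum
  obtain ⟨w, hw⟩ := hne
  rw [← hWeq] at hw
  obtain ⟨i, -⟩ := hw
  exact i.elim0

/-- Prisms over prisms over long even cycles: arbitrarily large `k`-regular, `k`-edge-connected
bipartite graphs with two far apart vertices of the same colour. -/
theorem exists_bipartite_regular_edgeConnected (k : ℕ) (hk : 2 ≤ k) (n : ℕ) :
    ∃ (V : Type) (_ : Fintype V) (G : SimpleGraph V) (f : V → ℤ) (u v : V),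
      n < Fintype.card V ∧ k < Fintype.card V ∧ (∀ x, (G.neighborSet x).ncard = k) ∧
      G.IsEdgeConnected k ∧ (∀ x, f x = 1 ∨ f x = -1) ∧ (∀ x y, G.Adj x y → f y = - f x) ∧
      ∑ x, f x = 0 ∧ f u = 1 ∧ f v = 1 ∧ u ≠ v ∧ ∀ x, G.Adj u x → ¬ G.Adj v x := by
  induction k, hk using Nat.le_induction with
  | base =>
    -- The cycle has length `m + 3 = 2 * n + 8`, so that `0` and `4` have no common neighbour.
    let m := 2 * n + 5
    have hev : Even (m + 3) := ⟨n + 4, by omega⟩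
    let c := SimpleGraph.cycleGraph.bicoloring_of_even (m + 3) hev
    let f : Fin (m + 3) → ℤ := fun x => if c x = c 0 then 1 else -1
    have hf : ∀ x y, (SimpleGraph.cycleGraph (m + 3)).Adj x y → f y = - f x := by
      intro x y hxy
      have := c.valid hxy
      cases hx : c x <;> cases hy : c y <;> cases hz : c 0 <;> simp_all [f]
    refine ⟨Fin (m + 3), inferInstance, SimpleGraph.cycleGraph (m + 3), f, 0, ⟨4, by omega⟩, ?_, ?_, ?_,
      SimpleGraph.isEdgeConnected_two_cycleGraph m, ?_, ?_, ?_, ?_, ?_, ?_, ?_⟩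
    · simp [m]; omega
    · simp
    · intro x
      rw [Set.ncard_eq_toFinset_card', ← SimpleGraph.cycleGraph_degree_three_le (v := x)]
      rfl
    · intro x
      by_cases h : c x = c 0 <;> simp [f, h]
    · exact hf
    · -- The rotation by one step negates `f`.
      have h : ∀ x, f (x + 1) = - f x := fun x => hf _ _ (by simp [SimpleGraph.cycleGraph_adj])
      have h2 := Equiv.sum_comp (Equiv.addRight (1 : Fin (m + 3))) f
      simp only [Equiv.coe_addRight, h, Finset.sum_neg_distrib] at h2
      omega
    · simp [f]
    · simp only [f]
      refine if_pos ?_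
      change decide (4 % 2 = 0) = decide ((0 : Fin (m + 3)).val % 2 = 0)
      simp
    · simp [Fin.ext_iff]
    · intro x hx hx'
      rw [SimpleGraph.cycleGraph_adj'] at hx hx'
      have := x.isLt
      simp only [Fin.sub_def, Fin.val_zero] at hx hx'
      have hmod : ∀ t, (t < m + 3 → t % (m + 3) = t) ∧
          (m + 3 ≤ t → t < 2 * (m + 3) → t % (m + 3) = t - (m + 3)) := fun t =>
        ⟨Nat.mod_eq_of_lt, fun h1 h2 => by
          rw [Nat.mod_eq_sub_mod h1, Nat.mod_eq_of_lt (by omega)]⟩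
      have h1 := hmod (m + 3 - x + 0)
      have h2 := hmod (m + 3 - 0 + x)
      have h3 := hmod (m + 3 - x + 4)
      have h4 := hmod (m + 3 - 4 + x)
      omega
  | succ k hk ih =>
    obtain ⟨V, _, G, f, u, v, hn, hcard, hdeg, hconn, hf1, hf, hsum, huv, hv, hne, hfar⟩ := ih
    have hcard' : Fintype.card (V × Bool) = 2 * Fintype.card V := by
      simp [mul_comm]
    refine ⟨V × Bool, inferInstance, G □ ⊤, fun x => if x.2 then f x.1 else - f x.1, (u, true),
      (v, true), by omega, by omega, ?_, hconn.prism (by omega) (by simpa using hcard), ?_, ?_, ?_,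
      ?_, ?_, ?_, ?_⟩
    · rintro ⟨x, b⟩
      rw [SimpleGraph.neighborSet_boxProd, Set.ncard_union_eq, Set.ncard_prod, Set.ncard_prod,
        hdeg, Set.ncard_singleton, Set.ncard_singleton, mul_one, one_mul]
      · congr 1
        rw [Set.ncard_eq_one]
        exact ⟨!b, by ext c; cases b <;> cases c <;> simp⟩
      · rw [Set.disjoint_left]
        rintro ⟨y, c⟩ ⟨h1, -⟩ ⟨h2, -⟩
        obtain rfl : y = x := h2
        exact G.irrefl h1
    · rintro ⟨x, b⟩
      have := hf1 x
      cases b <;> simp <;> omega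
    · rintro ⟨x, b⟩ ⟨y, c⟩ hxy
      rw [SimpleGraph.boxProd_adj] at hxy
      rcases hxy with ⟨h, rfl : b = c⟩ | ⟨h, rfl : x = y⟩
      · have := hf _ _ h
        cases b <;> simp [this]
      · cases b <;> cases c <;> simp_all
    · simp [Fintype.sum_prod_type]
    · simpa using huv
    · simpa using hv
    · simpa using hne
    · rintro ⟨x, b⟩ h1 h2
      rw [SimpleGraph.boxProd_adj] at h1 h2
      simp only [SimpleGraph.top_adj] at h1 h2
      rcases h1 with ⟨h1, rfl⟩ | ⟨h1, rfl⟩ <;> rcases h2 with ⟨h2, h3⟩ | ⟨h2, h3⟩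
      · exact hfar x h1 h2
      · exact h2 rfl
      · exact h1 h3
      · exact hne h3.symm

theorem infinitelyManyPairs_bipartite (r : ℕ) (hr : 4 ≤ r) :
    InfinitelyManyPairs fun p =>
      p.G.IsEdgeConnected r ∧ IsRegularGraph r p.G ∧ p.G.IsBipartite ∧
        p.EvenAndFarApart ∧ ¬ HasSpanningPathCycleSystem p.G (p.W : Set (Fin p.order)) := by
  classical
  refine .of_forall_exists_order_gt fun n => ?_
  obtain ⟨V, _, G, f, u, v, hn, -, hdeg, hconn, hf1, hf, hsum, hu, hv, hne, hfar⟩ :=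
    exists_bipartite_regular_edgeConnected r (by omega) n
  refine ⟨.ofGraph G {u, v}, ⟨hconn.of_iso (G.overFinIso rfl),
    (isRegularGraph_of_ncard hdeg).of_iso (G.overFinIso rfl), ?_,
    GraphPair.evenAndFarApart_ofGraph ?_ ?_,
    GraphPair.not_hasSpanningPathCycleSystem_ofGraph
      (not_hasSpanningPathCycleSystem_of_balanced hf hsum ⟨u, by simp⟩ ?_)⟩, hn⟩
  · refine SimpleGraph.Colorable.of_hom (G' := G) (G.overFinIso rfl).symm.toHom ?_
    have hc : G.Colorable (Fintype.card Bool) :=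
      (SimpleGraph.Coloring.mk (fun x => decide (f x = 1)) fun {x y} hxy => by
        have := hf x y hxy
        rcases hf1 x with h | h <;> simp [this, h]).colorable
    simpa using hc
  · rw [Finset.card_pair hne]
    exact even_two
  · have hnadj : ¬ G.Adj u v := fun h => by
      have := hf _ _ h
      omega
    intro x hx y hy hxy
    simp only [Finset.mem_insert, Finset.mem_singleton] at hx hy
    rcases hx with rfl | rfl <;> rcases hy with rfl | rfl
    · exact absurd rfl hxy
    · exact ⟨hnadj, hfar⟩
    · exact ⟨fun h => hnadj h.symm, fun z h1 h2 => hfar z h2 h1⟩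
    · exact absurd rfl hxy
  · intro x hx
    simp only [Finset.coe_insert, Finset.coe_singleton, Set.mem_insert_iff,
      Set.mem_singleton_iff] at hx
    rcases hx with rfl | rfl <;> assumption

/-! ### Obstructions -/

/-- In an `r`-regular graph the leaves of an induced `K_{1,r}` are all the neighbours of its centre,
so a centre lying in a triangle is impossible. -/
theorem starFree_of_forall_triangle {V : Type*} [Finite V] {G : SimpleGraph V} {r : ℕ}
    (hdeg : ∀ v, (G.neighborSet v).ncard = r)
    (htri : ∀ x, ∃ y z, G.Adj x y ∧ G.Adj x z ∧ G.Adj y z) : StarFree r G := by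
  rintro ⟨f⟩
  have hinj : Function.Injective fun i => f (Sum.inr i) :=
    f.injective.comp Sum.inr_injective
  have hsub : Set.range (fun i => f (Sum.inr i)) ⊆ G.neighborSet (f (Sum.inl 0)) := by
    rintro _ ⟨i, rfl⟩
    exact f.map_adj_iff.2 (by simp)
  have heq := Set.eq_of_subset_of_ncard_le hsub (by
    rw [hdeg, ← Set.image_univ, Set.ncard_image_of_injective _ hinj, Set.ncard_univ]
    simp) (Set.toFinite _)
  obtain ⟨y, z, hy, hz, hyz⟩ := htri (f (Sum.inl 0))
  rw [← SimpleGraph.mem_neighborSet, ← heq] at hy hz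
  obtain ⟨i, rfl⟩ := hy
  obtain ⟨j, rfl⟩ := hz
  simpa using f.map_adj_iff.1 hyz

/-- Let `S ⊆ W` and let every component of `G - S` contain at most one vertex of `W`. A path of a
spanning path-cycle system meets `S` only in its ends, so one of these ends lies in `S`; hence there
are at most `|S|` paths and `|W| ≤ 2 |S|`. -/
theorem not_hasSpanningPathCycleSystem_of_separator {V κ : Type*} {G : SimpleGraph V}
    {S W : Finset V} (comp : V → κ)
    (hcomp : ∀ u v, u ∉ S → v ∉ S → G.Adj u v → comp u = comp v)
    (hW : ∀ u ∈ W, ∀ v ∈ W, u ∉ S → v ∉ S → comp u = comp v → u = v)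
    (hSW : S ⊆ W) (hcard : 2 * S.card < W.card) :
    ¬ HasSpanningPathCycleSystem G (W : Set V) := by
  classical
  rintro ⟨m, n, a, b, P, c, C, -, -, hPP, -, -, hab, hWeq, -⟩
  have hwalk : ∀ {u v : V} (p : G.Walk u v), (∀ x ∈ p.support, x ∉ S) → comp u = comp v := by
    intro u v p
    induction p with
    | nil => exact fun _ => rfl
    | cons h p ih =>
      intro hp
      refine (hcomp _ _ (hp _ (by simp)) (hp _ (by simp)) h).trans (ih fun x hx => hp x ?_)
      simp [hx]
  have hend : ∀ i, a i ∈ S ∨ b i ∈ S := by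
    intro i
    by_contra! h
    refine (hab i).2.2 (hW _ (hab i).1 _ (hab i).2.1 h.1 h.2 (hwalk (P i) fun x hx hxS => ?_))
    have hxW : x ∈ (W : Set V) := hSW hxS
    rw [← hWeq] at hxW
    obtain ⟨j, hj⟩ := hxW
    have hij : i = j := by
      by_contra hij
      refine hPP i j hij hx ?_
      rcases hj with rfl | rfl <;> simp
    subst hij
    rcases hj with rfl | rfl
    exacts [h.1 hxS, h.2 hxS]
  have hm : m ≤ S.card := by
    let g : Fin m → V := fun i => if a i ∈ S then a i else b i
    have hgS : ∀ i, g i ∈ (P i).support := fun i => by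
      simp only [g]; split_ifs <;> simp
    rw [← Fintype.card_fin m, ← Finset.card_univ]
    refine Finset.card_le_card_of_injOn g (fun i _ => ?_) fun i _ j _ hij => ?_
    · simp only [g]
      split_ifs with h
      exacts [h, (hend i).resolve_left h]
    · by_contra hne
      exact hPP i j hne (hgS i) (hij ▸ hgS j)
  have hW2 : W.card ≤ 2 * m := by
    have hsub : W ⊆ Finset.univ.image a ∪ Finset.univ.image b := by
      intro x hx
      have hx' : x ∈ (W : Set V) := hx
      rw [← hWeq] at hx'
      obtain ⟨i, rfl | rfl⟩ := hx' <;> simp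
    calc W.card ≤ _ := Finset.card_le_card hsub
      _ ≤ _ := Finset.card_union_le _ _
      _ ≤ m + m := by
        gcongr <;> simpa using Finset.card_image_le (s := (Finset.univ : Finset (Fin m)))
      _ = 2 * m := by ring
  omega

/-! ### Plugs -/

/-- A plug: a graph all of whose degrees become `r` once every port `τ a` receives one more edge,
which is `|C|`-edge-connected and each of whose vertices lies in a triangle. -/
structure IsPlug (r : ℕ) {C V : Type*} (G : SimpleGraph V) (τ : C → V) : Prop where
  injective : Function.Injective τ
  degree : ∀ v, (G.neighborSet v).ncard + {a | τ a = v}.ncard = r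
  edgeConnected : G.IsEdgeConnected (Nat.card C)
  triangle : ∀ x, ∃ y z, G.Adj x y ∧ G.Adj x z ∧ G.Adj y z

/-- The complete graph on `(Fin ρ × Bool) ⊕ Fin q` without the perfect matching of `Fin ρ × Bool`
that joins `(j, false)` to `(j, true)`. -/
def completeMinusMatching (ρ q : ℕ) : SimpleGraph ((Fin ρ × Bool) ⊕ Fin q) where
  Adj x y := x ≠ y ∧ y ≠ Sum.map (Prod.map id not) id x
  symm.symm := by
    rintro (⟨j, x⟩ | i) (⟨k, y⟩ | l) <;> simp [eq_comm]
  loopless.irrefl x h := h.1 rfl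

theorem neighborSet_completeMinusMatching {ρ q : ℕ} (x : (Fin ρ × Bool) ⊕ Fin q) :
    (completeMinusMatching ρ q).neighborSet x = {x, Sum.map (Prod.map id not) id x}ᶜ := by
  ext y
  simp [completeMinusMatching, eq_comm]

theorem ncard_neighborSet_completeMinusMatching {ρ q : ℕ} (x : (Fin ρ × Bool) ⊕ Fin q) :
    ((completeMinusMatching ρ q).neighborSet x).ncard + {a | Sum.inl a = x}.ncard + 1 =
      2 * ρ + q := by
  have h := Set.ncard_add_ncard_compl {x, Sum.map (Prod.map id not) id x}
  rw [← neighborSet_completeMinusMatching] at h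
  have hcard : Nat.card ((Fin ρ × Bool) ⊕ Fin q) = 2 * ρ + q := by
    simp [mul_comm]
  rw [hcard] at h
  rcases x with ⟨j, b⟩ | i
  · rw [Set.ncard_pair (by simp)] at h
    have : {a : Fin ρ × Bool | (Sum.inl a : (Fin ρ × Bool) ⊕ Fin q) = Sum.inl (j, b)} = {(j, b)} := by
      ext a; simp
    rw [this, Set.ncard_singleton]
    omega
  · simp at h ⊢
    omega

/-- Some vertex `w` is adjacent to all others, and every vertex has at least `2ρ` edge-disjoint
routes of length at most two to `w`. -/
theorem isPlug_completeMinusMatching {ρ q : ℕ} (hρ : 1 ≤ ρ) (hq : 2 ≤ q) :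
    IsPlug (2 * ρ + q - 1) (completeMinusMatching ρ q) Sum.inl where
  injective := Sum.inl_injective
  degree x := by
    have := ncard_neighborSet_completeMinusMatching x
    omega
  edgeConnected := by
    have hc : Nat.card (Fin ρ × Bool) = 2 * ρ := by simp [mul_comm]
    rw [hc]
    let w : (Fin ρ × Bool) ⊕ Fin q := Sum.inr ⟨0, by omega⟩
    have hw : ∀ y, y ≠ w → (completeMinusMatching ρ q).Adj y w := by
      rintro (y | y) hy <;> refine ⟨hy, ?_⟩
      · simp [w]
      · exact hy.symm
    have key : ∀ x (D : Set _), D.encard < (2 * ρ : ℕ) →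
        ((completeMinusMatching ρ q).deleteEdges D).Reachable x w := by
      intro x D hD
      -- A route of length at most two from `x` to `w` through every neighbour of `x`.
      obtain ⟨⟨y, hy⟩, hyD⟩ := exists_forall_notMem_of_encard_lt (k := 2 * ρ)
        (ι := (completeMinusMatching ρ q).neighborSet x) (by
          have := ncard_neighborSet_completeMinusMatching x
          have h1 : {a | (Sum.inl a : (Fin ρ × Bool) ⊕ Fin q) = x}.ncard ≤ 1 := by
            rw [Set.ncard_le_one_iff (Set.toFinite _)]
            rintro a b rfl h
            exact (Sum.inl_injective h).symm
          rw [Nat.card_coe_set_eq]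
          omega) hD (fun y => {s(x, y.1), s(y.1, w)}) (by
          rintro ⟨i, hi⟩ ⟨j, hj⟩ e he he'
          have hi' : x ≠ i := hi.1
          have hj' : x ≠ j := hj.1
          rcases he with rfl | rfl <;> rcases he' with h | h <;> simp at h <;> grind)
      have hadj : ∀ {p p'}, (completeMinusMatching ρ q).Adj p p' → s(p, p') ∉ D →
          ((completeMinusMatching ρ q).deleteEdges D).Reachable p p' :=
        fun h1 h2 => (SimpleGraph.deleteEdges_adj.2 ⟨h1, h2⟩).reachable
      have hxy := hadj hy (hyD _ (by simp))
      by_cases hyw : y = w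
      · exact hyw ▸ hxy
      · exact hxy.trans (hadj (hw y hyw) (hyD _ (by simp)))
    exact fun x y D hD => (key x D hD).trans (key y D hD).symm
  triangle := by
    have hadj : ∀ (b : Fin ρ × Bool) (i : Fin q),
        (completeMinusMatching ρ q).Adj (Sum.inl b) (Sum.inr i) := fun b i => ⟨by simp, by simp⟩
    have hadj' : ∀ i j : Fin q, i ≠ j →
        (completeMinusMatching ρ q).Adj (Sum.inr i) (Sum.inr j) :=
      fun i j h => ⟨by simpa using h, by simpa using h.symm⟩
    have : Nontrivial (Fin q) := Fin.nontrivial_iff_two_le.2 hq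
    rintro (b | i)
    · obtain ⟨i, j, hij⟩ := exists_pair_ne (Fin q)
      exact ⟨_, _, hadj b i, hadj b j, hadj' i j hij⟩
    · obtain ⟨j, hij⟩ := exists_ne i
      exact ⟨_, _, (hadj (⟨0, hρ⟩, true) i).symm, hadj' i j hij.symm, hadj _ j⟩

/-- The graph `G` with ports `τ : C → V` is extended by two cliques on `C`: the clique
`C × {false}` is matched to the ports, and the two cliques are joined along the relation `R`. -/
def extendPlug {C V : Type*} (R : C → C → Prop) [Std.Symm R] (G : SimpleGraph V) (τ : C → V) :
    SimpleGraph ((C × Bool) ⊕ V) where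
  Adj
    | .inl x, .inl y => x.2 = y.2 ∧ x.1 ≠ y.1 ∨ x.2 ≠ y.2 ∧ R x.1 y.1
    | .inl x, .inr v => x.2 = false ∧ τ x.1 = v
    | .inr v, .inl x => x.2 = false ∧ τ x.1 = v
    | .inr u, .inr v => G.Adj u v
  symm.symm := by
    rintro (x | u) (y | v) h
    · rcases h with h | h
      exacts [.inl ⟨h.1.symm, h.2.symm⟩, .inr ⟨h.1.symm, symm_of R h.2⟩]
    · exact h
    · exact h
    · exact SimpleGraph.Adj.symm h
  loopless.irrefl := by
    rintro (x | u) h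
    · rcases h with h | h
      exacts [h.2 rfl, h.1 rfl]
    · exact G.irrefl h

/-- The upper clique `C × {true}` carries the ports of the extended plug. Each vertex of a clique
has `|C|` routes, one through each vertex of its clique, to the next clique or to the old plug. -/
theorem IsPlug.extend {r : ℕ} {C V : Type*} [Finite C] [Finite V] {G : SimpleGraph V} {τ : C → V}
    (h : IsPlug r G τ) (R : C → C → Prop) [Std.Symm R] [Std.Refl R]
    (hR : ∀ a, {b | R a b}.ncard + Nat.card C = r)
    (htri : (∀ a, ∃ b, a ≠ b ∧ R a b) ∨ 3 ≤ Nat.card C) :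
    IsPlug r (extendPlug R G τ) (fun a => Sum.inl (a, true)) where
  injective a b hab := by simpa using hab
  degree := by
    have hclique : ∀ a : C, {b | a ≠ b}.ncard + 1 = Nat.card C := by
      intro a
      have : {b | a ≠ b} = {a}ᶜ := by ext b; simp [eq_comm]
      rw [this, ← Set.ncard_add_ncard_compl {a}, Set.ncard_singleton, add_comm]
    have hinl : ∀ (a : C) (b : Bool), (Sum.inl '' ((·, b) '' {c | a ≠ c} ∪ (·, !b) '' {c | R a c}) :
        Set ((C × Bool) ⊕ V)).ncard + 1 = r := by
      intro a b
      rw [Set.ncard_image_of_injective _ Sum.inl_injective, Set.ncard_union_eq,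
        Set.ncard_image_of_injective _ (Prod.mk_left_injective _),
        Set.ncard_image_of_injective _ (Prod.mk_left_injective _), ← hR a, ← hclique a]
      · ring
      · rw [Set.disjoint_left]
        rintro _ ⟨c, -, rfl⟩ ⟨d, -, hd⟩
        simp at hd
    rintro (⟨a, b⟩ | v)
    · cases b
      · have h1 : (extendPlug R G τ).neighborSet (.inl (a, false)) =
            (Sum.inl '' ((·, false) '' {c | a ≠ c} ∪ (·, !false) '' {c | R a c})) ∪
              {Sum.inr (τ a)} := by
          ext (⟨c, b⟩ | v)
          · cases b <;> simp [extendPlug]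
          · simp only [extendPlug, SimpleGraph.mem_neighborSet, true_and, Set.mem_union,
              Set.mem_singleton_iff, Sum.inr.injEq]
            simp [eq_comm]
        have h2 : {c : C | (Sum.inl (c, true) : (C × Bool) ⊕ V) = Sum.inl (a, false)} = ∅ := by
          ext; simp
        rw [h1, h2, Set.ncard_union_eq (by simp), Set.ncard_singleton, hinl, Set.ncard_empty, add_zero]
      · have h1 : (extendPlug R G τ).neighborSet (.inl (a, true)) =
            (Sum.inl '' ((·, true) '' {c | a ≠ c} ∪ (·, !true) '' {c | R a c})) := by
          ext (⟨c, b⟩ | v)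
          · cases b <;> simp [extendPlug]
          · simp [extendPlug]
        have h2 : {c : C | (Sum.inl (c, true) : (C × Bool) ⊕ V) = Sum.inl (a, true)} = {a} := by
          ext; simp
        rw [h1, h2, Set.ncard_singleton, hinl]
    · have h1 : (extendPlug R G τ).neighborSet (.inr v) =
          Sum.inr '' G.neighborSet v ∪ (fun a => Sum.inl (a, false)) '' {a | τ a = v} := by
        ext (⟨c, b⟩ | v)
        · cases b <;> simp [extendPlug]
        · simp [extendPlug]
      have h2 : {c : C | (Sum.inl (c, true) : (C × Bool) ⊕ V) = Sum.inr v} = ∅ := by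
        ext; simp
      rw [h1, h2, Set.ncard_empty, add_zero, Set.ncard_union_eq,
        Set.ncard_image_of_injective _ Sum.inr_injective, Set.ncard_image_of_injective, h.degree]
      · intro a b hab
        simpa using hab
      · rw [Set.disjoint_left]
        rintro _ ⟨c, -, rfl⟩ ⟨d, -, hd⟩
        simp at hd
  edgeConnected := by
    intro x y D hD
    set H := (extendPlug R G τ).deleteEdges D with hH
    have hadj : ∀ {p q}, (extendPlug R G τ).Adj p q → s(p, q) ∉ D → H.Reachable p q :=
      fun h1 h2 => (SimpleGraph.deleteEdges_adj.2 ⟨h1, h2⟩).reachable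
    have hold : ∀ u v, H.Reachable (.inr u) (.inr v) :=
      h.edgeConnected.reachable_map (⟨Sum.inr, fun h => h⟩ : G →g extendPlug R G τ)
        Sum.inr_injective hD
    have hclique : ∀ {a c b}, s(.inl (a, b), .inl (c, b)) ∉ D →
        H.Reachable (.inl (a, b)) (.inl (c, b)) := by
      intro a c b hac
      by_cases hne : a = c
      · rw [hne]
      · exact hadj (.inl ⟨rfl, hne⟩) hac
    have hvert : ∀ a, s(.inl (a, true), .inl (a, false)) ∉ D →
        H.Reachable (.inl (a, true)) (.inl (a, false)) :=
      fun a ha => hadj (.inr ⟨by simp, refl_of R a⟩) ha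
    -- For `c = a` the route below starts with a loop, which is no edge and does no harm.
    have hlow : ∀ a, ∃ v, H.Reachable (.inl (a, false)) (.inr v) := by
      intro a
      obtain ⟨c, hc⟩ := exists_forall_notMem_of_encard_lt le_rfl hD (fun c : C =>
        {s(.inl (a, false), .inl (c, false)), s(.inl (c, false), .inr (τ c))}) (by
          rintro i j e (rfl | rfl) (he | he) <;> simp at he <;> grind)
      exact ⟨τ c, (hclique (hc _ (by simp))).trans (hadj ⟨rfl, rfl⟩ (hc _ (by simp)))⟩
    have hup : ∀ a, ∃ v, H.Reachable (.inl (a, true)) (.inr v) := by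
      intro a
      obtain ⟨c, hc⟩ := exists_forall_notMem_of_encard_lt le_rfl hD (fun c : C =>
        {s(.inl (a, true), .inl (c, true)), s(.inl (c, true), .inl (c, false))}) (by
          rintro i j e (rfl | rfl) (he | he) <;> simp at he <;> grind)
      obtain ⟨v, hv⟩ := hlow c
      exact ⟨v, ((hclique (hc _ (by simp))).trans
        (hvert c (hc _ (by simp)))).trans hv⟩
    have key : ∀ z, ∃ v, H.Reachable z (.inr v) := by
      rintro (⟨a, _ | _⟩ | v)
      exacts [hlow a, hup a, ⟨v, .rfl⟩]
    obtain ⟨u, hu⟩ := key x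
    obtain ⟨v, hv⟩ := key y
    exact (hu.trans (hold u v)).trans hv.symm
  triangle := by
    rintro (⟨a, b⟩ | v)
    · rcases htri with htri | htri
      · obtain ⟨c, hc, hR⟩ := htri a
        exact ⟨.inl (c, b), .inl (a, !b), .inl ⟨rfl, hc⟩, .inr ⟨by simp, refl_of R a⟩,
          .inr ⟨by simp, symm_of R hR⟩⟩
      · have hcard : 2 < (Set.univ : Set C).ncard := by rw [Set.ncard_univ]; omega
        obtain ⟨c, -, hc⟩ := Set.exists_ne_of_one_lt_ncard (lt_trans one_lt_two hcard) a
        have h2 : ∃ d, d ≠ a ∧ d ≠ c := by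
          by_contra! hd
          have : (Set.univ : Set C) ⊆ {a, c} := fun d _ => by
            by_cases h : d = a
            exacts [.inl h, .inr (hd d h)]
          have h3 := Set.ncard_le_ncard this
          rw [Set.ncard_pair hc.symm] at h3
          omega
        obtain ⟨d, hda, hdc⟩ := h2
        exact ⟨.inl (c, b), .inl (d, b), .inl ⟨rfl, hc.symm⟩, .inl ⟨rfl, hda.symm⟩,
          .inl ⟨rfl, hdc.symm⟩⟩
    · obtain ⟨y, z, hy, hz, hyz⟩ := h.triangle v
      exact ⟨.inr y, .inr z, hy, hz, hyz⟩

/-- Extending a plug again and again gives arbitrarily large plugs whose ports are pairwise adjacent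
and which have a vertex `w` that neither is a port nor has a port as a neighbour. -/
theorem exists_isPlug {r ρ : ℕ} (hρ : 1 ≤ ρ) (hr : 2 * ρ + 1 ≤ r)
    (R : Fin ρ × Bool → Fin ρ × Bool → Prop) [Std.Symm R] [Std.Refl R]
    (hR : ∀ a, {b | R a b}.ncard + 2 * ρ = r)
    (htri : (∀ a, ∃ b, a ≠ b ∧ R a b) ∨ 2 ≤ ρ) (n : ℕ) :
    ∃ (V : Type) (_ : Fintype V) (G : SimpleGraph V) (τ : Fin ρ × Bool → V) (w : V),
      IsPlug r G τ ∧ n < Fintype.card V ∧ (∀ a b, a ≠ b → G.Adj (τ a) (τ b)) ∧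
      ∀ a, τ a ≠ w ∧ ¬ G.Adj w (τ a) := by
  have hc : Nat.card (Fin ρ × Bool) = 2 * ρ := by simp [mul_comm]
  have hR' : ∀ a, {b | R a b}.ncard + Nat.card (Fin ρ × Bool) = r := by rwa [hc]
  have htri' : (∀ a, ∃ b, a ≠ b ∧ R a b) ∨ 3 ≤ Nat.card (Fin ρ × Bool) :=
    htri.imp_right fun h => by omega
  have hlarge : ∀ n, ∃ (V : Type) (_ : Fintype V) (G : SimpleGraph V) (τ : Fin ρ × Bool → V),
      IsPlug r G τ ∧ n < Fintype.card V := by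
    intro n
    induction n with
    | zero =>
      have h := isPlug_completeMinusMatching (q := r + 1 - 2 * ρ) hρ (by omega)
      rw [show 2 * ρ + (r + 1 - 2 * ρ) - 1 = r by omega] at h
      exact ⟨_, inferInstance, _, _, h, Fintype.card_pos_iff.2 ⟨.inl (⟨0, hρ⟩, true)⟩⟩
    | succ n ih =>
      obtain ⟨V, _, G, τ, h, hn⟩ := ih
      refine ⟨_, inferInstance, _, _, h.extend R hR' htri', ?_⟩
      simp only [Fintype.card_sum, Fintype.card_prod, Fintype.card_fin, Fintype.card_bool]
      omega
  obtain ⟨V, _, G, τ, h, hn⟩ := hlarge n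
  obtain ⟨w⟩ : Nonempty V := Fintype.card_pos_iff.1 (by omega)
  refine ⟨_, inferInstance, _, _, .inr w, h.extend R hR' htri', ?_, ?_, ?_⟩
  · rw [Fintype.card_sum]
    omega
  · exact fun a b hab => .inl ⟨rfl, hab⟩
  · exact fun a => ⟨by simp, fun h => by simpa using h.1⟩

/-! ### Joining copies of a plug through separating vertices -/

/-- Copies of the graph `P`, indexed by `I`, together with an independent set `S`: the port `τ a` of
the copy `i` is joined to the vertex `o i a` of `S`. -/
def assemblePlugs {S I C V : Type*} (P : SimpleGraph V) (τ : C → V) (o : I → C → S) :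
    SimpleGraph (S ⊕ (I × V)) where
  Adj
    | .inl _, .inl _ => False
    | .inl s, .inr x => ∃ a, τ a = x.2 ∧ o x.1 a = s
    | .inr x, .inl s => ∃ a, τ a = x.2 ∧ o x.1 a = s
    | .inr x, .inr y => x.1 = y.1 ∧ P.Adj x.2 y.2
  symm.symm := by
    rintro (s | x) (t | y) h
    exacts [h, h, h, ⟨h.1.symm, h.2.symm⟩]
  loopless.irrefl := by
    rintro (s | x) h
    exacts [h, P.irrefl h.2]

section Assemble

variable {S I C V : Type*} {P : SimpleGraph V} {τ : C → V} {o : I → C → S} {r : ℕ}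

theorem ncard_neighborSet_assemblePlugs [Finite S] [Finite I] [Finite C] [Finite V]
    (h : IsPlug r P τ) (ho : ∀ s, {p : I × C | o p.1 p.2 = s}.ncard = r) (x : S ⊕ (I × V)) :
    ((assemblePlugs P τ o).neighborSet x).ncard = r := by
  rcases x with s | ⟨i, v⟩
  · have h1 : (assemblePlugs P τ o).neighborSet (.inl s) =
        (fun p : I × C => Sum.inr (p.1, τ p.2)) '' {p | o p.1 p.2 = s} := by
      ext (t | ⟨i, v⟩)
      · simp [assemblePlugs]
      · simp only [assemblePlugs, SimpleGraph.mem_neighborSet, Set.mem_image, Set.mem_ofPred_eq,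
          Sum.inr.injEq, Prod.mk.injEq]
        constructor
        · rintro ⟨a, rfl, rfl⟩
          exact ⟨(i, a), rfl, rfl, rfl⟩
        · rintro ⟨⟨j, a⟩, rfl, rfl, rfl⟩
          exact ⟨a, rfl, rfl⟩
    rw [h1, Set.ncard_image_of_injective, ho]
    rintro ⟨i, a⟩ ⟨j, b⟩ hab
    simp only [Sum.inr.injEq, Prod.mk.injEq] at hab
    rw [hab.1, h.injective hab.2]
  · have h1 : (assemblePlugs P τ o).neighborSet (.inr (i, v)) =
        (fun u => Sum.inr (i, u)) '' P.neighborSet v ∪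
          (fun a => Sum.inl (o i a)) '' {a | τ a = v} := by
      ext (t | ⟨j, u⟩)
      · simp [assemblePlugs]
      · simp [assemblePlugs, and_comm, eq_comm]
    rw [h1, Set.ncard_union_eq, Set.ncard_image_of_injective, Set.InjOn.ncard_image, h.degree]
    · rintro a rfl b hb -
      exact (h.injective hb).symm
    · intro u w huw
      simpa using huw
    · rw [Set.disjoint_left]
      rintro _ ⟨c, -, rfl⟩ ⟨d, -, hd⟩
      simp at hd

theorem exists_triangle_assemblePlugs (h : IsPlug r P τ)
    (hport : ∀ a b, a ≠ b → P.Adj (τ a) (τ b))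
    (ho : ∀ s, ∃ i a b, a ≠ b ∧ o i a = s ∧ o i b = s) (x : S ⊕ (I × V)) :
    ∃ y z, (assemblePlugs P τ o).Adj x y ∧ (assemblePlugs P τ o).Adj x z ∧
      (assemblePlugs P τ o).Adj y z := by
  rcases x with s | ⟨i, v⟩
  · obtain ⟨i, a, b, hab, ha, hb⟩ := ho s
    exact ⟨.inr (i, τ a), .inr (i, τ b), ⟨a, rfl, ha⟩, ⟨b, rfl, hb⟩, rfl, hport a b hab⟩
  · obtain ⟨y, z, hy, hz, hyz⟩ := h.triangle v
    exact ⟨.inr (i, y), .inr (i, z), ⟨rfl, hy⟩, ⟨rfl, hz⟩, rfl, hyz⟩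

/-- All of `S` together with the vertex `w` of the copies indexed by `J`. -/
def assembledEnds [Fintype S] (w : V) (J : Finset I) : Finset (S ⊕ (I × V)) :=
  Finset.univ.disjSum (J.map ⟨fun i => (i, w), Prod.mk_left_injective w⟩)

theorem mem_assembledEnds [Fintype S] {w : V} {J : Finset I} {x : S ⊕ (I × V)} :
    x ∈ assembledEnds w J ↔ (∃ s, x = .inl s) ∨ ∃ i ∈ J, x = .inr (i, w) := by
  rcases x with s | ⟨i, v⟩
  · simp [assembledEnds]
  · simp [assembledEnds, eq_comm]

theorem card_assembledEnds [Fintype S] (w : V) (J : Finset I) :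
    (assembledEnds w J : Finset (S ⊕ (I × V))).card = Fintype.card S + J.card := by
  simp [assembledEnds, Finset.card_disjSum]

/-- A vertex of a plug has at most one neighbour in `S`, and the vertices `w` are at distance at least
two from the ports. -/
theorem assembledEnds_far [Fintype S] (h : IsPlug r P τ) {w : V}
    (hw : ∀ a, τ a ≠ w ∧ ¬ P.Adj w (τ a)) (J : Finset I) (u : S ⊕ (I × V))
    (hu : u ∈ assembledEnds w J) (v : S ⊕ (I × V)) (hv : v ∈ assembledEnds w J) (huv : u ≠ v) :
    ¬ (assemblePlugs P τ o).Adj u v ∧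
      ∀ x, (assemblePlugs P τ o).Adj u x → ¬ (assemblePlugs P τ o).Adj v x := by
  rcases mem_assembledEnds.1 hu with ⟨s, rfl⟩ | ⟨i, -, rfl⟩ <;>
    rcases mem_assembledEnds.1 hv with ⟨t, rfl⟩ | ⟨j, -, rfl⟩
  · refine ⟨fun h => h, ?_⟩
    rintro (x | ⟨k, x⟩) h1 h2
    · exact h1
    · obtain ⟨a, ha, has⟩ := h1
      obtain ⟨b, hb, hbt⟩ := h2
      obtain rfl := h.injective (ha.trans hb.symm)
      exact huv (by rw [← has, ← hbt])
  · refine ⟨fun ⟨a, ha, _⟩ => (hw a).1 ha, ?_⟩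
    rintro (x | ⟨k, x⟩) h1 h2
    · exact h1
    · obtain ⟨a, rfl, -⟩ := h1
      exact (hw a).2 h2.2
  · refine ⟨fun ⟨a, ha, _⟩ => (hw a).1 ha, ?_⟩
    rintro (x | ⟨k, x⟩) h1 h2
    · exact h2
    · obtain ⟨a, rfl, -⟩ := h2
      exact (hw a).2 h1.2
  · refine ⟨fun h => P.irrefl h.2, ?_⟩
    rintro (x | ⟨k, x⟩) h1 h2
    · obtain ⟨a, ha, -⟩ := h1
      exact (hw a).1 ha
    · have hij : i = j := h1.1.trans h2.1.symm
      exact huv (by rw [hij])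

theorem not_hasSpanningPathCycleSystem_assemblePlugs [Fintype S] (w : V) (J : Finset I)
    (hJ : Fintype.card S < J.card) :
    ¬ HasSpanningPathCycleSystem (assemblePlugs P τ o)
      ((assembledEnds w J : Finset (S ⊕ (I × V))) : Set (S ⊕ (I × V))) := by
  refine not_hasSpanningPathCycleSystem_of_separator (S := Finset.univ.map .inl)
    (Sum.elim (fun _ => none) fun x : I × V => some x.1) ?_ ?_ ?_ ?_
  · rintro (s | x) (t | y) hu hv h
    · exact absurd h (by simp [assemblePlugs])
    · simp at hu
    · simp at hv
    · simpa using h.1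
  · intro u hu v hv huS hvS huv
    rcases mem_assembledEnds.1 hu with ⟨s, rfl⟩ | ⟨i, -, rfl⟩
    · simp at huS
    rcases mem_assembledEnds.1 hv with ⟨t, rfl⟩ | ⟨j, -, rfl⟩
    · simp at hvS
    obtain rfl : i = j := by simpa using huv
    rfl
  · intro x hx
    obtain ⟨s, -, rfl⟩ := Finset.mem_map.1 hx
    exact mem_assembledEnds.2 (.inl ⟨s, rfl⟩)
  · rw [Finset.card_map, card_assembledEnds, Finset.card_univ]
    omega

end Assemble

/-! ### The joining pattern -/

/-- The separating vertices come in `2ρ` groups `u` of `ρ` vertices `(u, j)`. Each group has `t`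
plugs of its own, which meet every vertex of the group twice; and there are `ρ * e` further plugs
`(j, y)`, whose port `u` is joined to the vertex `(u, j)`. -/
def joiningPattern (ρ t e : ℕ) :
    ((Fin ρ × Bool) × Fin t) ⊕ (Fin ρ × Fin e) → Fin ρ × Bool → (Fin ρ × Bool) × Fin ρ
  | .inl p, a => (p.1, a.1)
  | .inr q, a => (a, q.1)

theorem ncard_fiber_joiningPattern {ρ t e : ℕ} (s : (Fin ρ × Bool) × Fin ρ) :
    {p : (((Fin ρ × Bool) × Fin t) ⊕ (Fin ρ × Fin e)) × (Fin ρ × Bool) |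
      joiningPattern ρ t e p.1 p.2 = s}.ncard = 2 * t + e := by
  obtain ⟨u, j⟩ := s
  let g : (Fin t × Bool) ⊕ Fin e →
      (((Fin ρ × Bool) × Fin t) ⊕ (Fin ρ × Fin e)) × (Fin ρ × Bool) :=
    Sum.elim (fun p => (.inl (u, p.1), (j, p.2))) (fun y => (.inr (j, y), u))
  have hg : Function.Injective g := by
    rintro (⟨i, b⟩ | y) (⟨i', b'⟩ | y') h <;> simp_all [g]
  have heq : {p : (((Fin ρ × Bool) × Fin t) ⊕ (Fin ρ × Fin e)) × (Fin ρ × Bool) |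
      joiningPattern ρ t e p.1 p.2 = (u, j)} = Set.range g := by
    ext ⟨⟨u', i⟩ | ⟨j', y⟩, ⟨j'', b⟩⟩
    · simp only [joiningPattern, Set.mem_ofPred_eq, Prod.mk.injEq, Set.mem_range]
      constructor
      · rintro ⟨rfl, rfl⟩
        exact ⟨.inl (i, b), rfl⟩
      · rintro ⟨⟨i, b⟩ | y, h⟩ <;> simp_all [g]
    · simp only [joiningPattern, Set.mem_ofPred_eq, Prod.mk.injEq, Set.mem_range]
      constructor
      · rintro ⟨rfl, rfl⟩
        exact ⟨.inr y, rfl⟩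
      · rintro ⟨⟨i, b⟩ | y, h⟩ <;> simp_all [g]
  rw [heq, ← Set.image_univ, Set.ncard_image_of_injective _ hg, Set.ncard_univ]
  simp [mul_comm]

/-- Fewer than `2ρ` deleted edges leave the edges at one of the `2ρ` groups intact, and this group
holds all the plugs `(j, y)` together; every other plug and every separating vertex has `2ρ`
edge-disjoint routes to these plugs. -/
theorem isEdgeConnected_assemblePlugs {V : Type*} [Finite V] {P : SimpleGraph V} {r ρ t e : ℕ}
    {τ : Fin ρ × Bool → V} (h : IsPlug r P τ) (ht : 1 ≤ t) (he : 2 ≤ e)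
    (hr : 2 * t + e = r) (hρr : 2 * ρ ≤ r) :
    (assemblePlugs P τ (joiningPattern ρ t e)).IsEdgeConnected (2 * ρ) := by
  have hc : Nat.card (Fin ρ × Bool) = 2 * ρ := by simp [mul_comm]
  intro x y D hD
  set H := (assemblePlugs P τ (joiningPattern ρ t e)).deleteEdges D with hH
  have hplug : ∀ i u v, H.Reachable (.inr (i, u)) (.inr (i, v)) := by
    intro i
    exact h.edgeConnected.reachable_map
      (⟨fun v => .inr (i, v), fun h => ⟨rfl, h⟩⟩ : P →g assemblePlugs P τ (joiningPattern ρ t e))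
      (fun u v huv => congrArg Prod.snd (Sum.inr_injective huv)) (by rwa [hc])
  have hadj : ∀ i a, (assemblePlugs P τ (joiningPattern ρ t e)).Adj
      (.inl (joiningPattern ρ t e i a)) (.inr (i, τ a)) := fun i a => ⟨a, rfl, rfl⟩
  have hedge : ∀ i a, s(.inl (joiningPattern ρ t e i a), .inr (i, τ a)) ∉ D →
      H.Reachable (.inl (joiningPattern ρ t e i a)) (.inr (i, τ a)) :=
    fun i a ha => (SimpleGraph.deleteEdges_adj.2 ⟨hadj i a, ha⟩ : H.Adj _ _).reachable
  obtain ⟨u₀, hu₀⟩ := exists_forall_notMem_of_encard_lt hc.ge hD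
    (fun u : Fin ρ × Bool => {f | ∃ j x, f = s(.inl (u, j), .inr x)}) (by
      rintro u u' f ⟨j, x, rfl⟩ ⟨j', x', hf⟩
      simp at hf
      exact hf.1.1)
  have hρ : 1 ≤ ρ := by have := u₀.1.isLt; omega
  let z : ((Fin ρ × Bool) × Fin ρ) ⊕
      ((((Fin ρ × Bool) × Fin t) ⊕ (Fin ρ × Fin e)) × V) :=
    .inr (.inl (u₀, ⟨0, ht⟩), τ u₀)
  have hgroup : ∀ j, H.Reachable (.inl (u₀, j)) z := by
    intro j
    exact (hedge (.inl (u₀, ⟨0, ht⟩)) (j, true) (hu₀ _ ⟨_, _, rfl⟩)).trans (hplug _ _ _)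
  have hhub : ∀ q v, H.Reachable (.inr (.inr q, v)) z := by
    intro q v
    exact ((hplug _ _ _).trans (hedge (.inr q) u₀ (hu₀ _ ⟨_, _, rfl⟩)).symm).trans (hgroup q.1)
  have hinr : ∀ p, H.Reachable (.inr p) z := by
    rintro ⟨⟨u, i⟩ | q, v⟩
    · -- The two ports at `(u, j)` are continued to different plugs `(j, 0)` and `(j, 1)`.
      let y : Bool → Fin e := fun b => if b then ⟨1, by omega⟩ else ⟨0, by omega⟩
      have hy : ∀ b b', y b = y b' → b = b' := by
        intro b b'
        cases b <;> cases b' <;> simp [y]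
      obtain ⟨a, ha⟩ := exists_forall_notMem_of_encard_lt hc.ge hD
        (fun a : Fin ρ × Bool => {s(.inl (u, a.1), .inr (.inl (u, i), τ a)),
          s(.inl (u, a.1), .inr (.inr (a.1, y a.2), τ u))}) (by
          rintro ⟨j, b⟩ ⟨j', b'⟩ f (rfl | rfl) (hf | hf)
          · simp at hf
            exact h.injective hf.2
          · simp at hf
          · simp at hf
          · simp at hf
            rw [hf.1, hy _ _ hf.2])
      have h1 := hedge (.inl (u, i)) a (ha _ (by simp [joiningPattern]))
      have h2 := hedge (.inr (a.1, y a.2)) u (ha _ (by simp [joiningPattern]))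
      exact ((hplug _ _ _).trans h1.symm).trans (h2.trans (hhub _ _))
    · exact hhub q v
  have hinl : ∀ s, H.Reachable (.inl s) z := by
    intro s
    have hdeg := ncard_neighborSet_assemblePlugs h (o := joiningPattern ρ t e)
      (fun s => (ncard_fiber_joiningPattern s).trans hr) (.inl s)
    obtain ⟨⟨p, hp⟩, hpD⟩ := exists_forall_notMem_of_encard_lt (k := 2 * ρ)
      (ι := (assemblePlugs P τ (joiningPattern ρ t e)).neighborSet (.inl s))
      (by rw [Nat.card_coe_set_eq, hdeg]; exact hρr) hD (fun p => {s(.inl s, p.1)}) (by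
        rintro p q f rfl hf
        exact Subtype.ext (Sym2.congr_right.1 hf))
    have h1 : H.Reachable (.inl s) p :=
      (SimpleGraph.deleteEdges_adj.2 ⟨hp, hpD _ rfl⟩ : H.Adj _ _).reachable
    rcases p with s' | p
    · exact absurd hp (by simp [assemblePlugs])
    · exact h1.trans (hinr p)
  have key : ∀ p, H.Reachable p z := by
    rintro (s | p)
    exacts [hinl s, hinr p]
  exact (key x).trans (key y).symm

/-- There are `2ρ²` separating vertices and `2ρt + ρe` plugs, and `2ρ² + 2` of the plugs contribute
a vertex to `W`. The relation `R` fixes the joins inside the plugs. -/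
theorem infinitelyManyPairs_starFree {r ρ t e : ℕ} (hρ : 1 ≤ ρ) (hρr : 2 * ρ + 1 ≤ r)
    (ht : 1 ≤ t) (he : 2 ≤ e) (hr : 2 * t + e = r)
    (hcount : 2 * ρ * ρ + 2 ≤ 2 * ρ * t + ρ * e)
    (R : Fin ρ × Bool → Fin ρ × Bool → Prop) [Std.Symm R] [Std.Refl R]
    (hR : ∀ a, {b | R a b}.ncard + 2 * ρ = r)
    (htri : (∀ a, ∃ b, a ≠ b ∧ R a b) ∨ 2 ≤ ρ) :
    InfinitelyManyPairs fun p =>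
      StarFree r p.G ∧ p.G.IsEdgeConnected (2 * ρ) ∧ IsRegularGraph r p.G ∧
        p.EvenAndFarApart ∧ ¬ HasSpanningPathCycleSystem p.G (p.W : Set (Fin p.order)) := by
  refine .of_forall_exists_order_gt fun n => ?_
  obtain ⟨V, _, P, τ, w, h, hn, hport, hw⟩ := exists_isPlug hρ hρr R hR htri n
  have hS : Fintype.card ((Fin ρ × Bool) × Fin ρ) = 2 * ρ * ρ := by
    simp only [Fintype.card_prod, Fintype.card_fin, Fintype.card_bool]
    ring
  have hI : Fintype.card (((Fin ρ × Bool) × Fin t) ⊕ (Fin ρ × Fin e)) = 2 * ρ * t + ρ * e := by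
    
    simp only [Fintype.card_sum, Fintype.card_prod, Fintype.card_fin, Fintype.card_bool]
    ring
  obtain ⟨J, -, hJ⟩ := Finset.exists_subset_card_eq
    (s := (Finset.univ : Finset (((Fin ρ × Bool) × Fin t) ⊕ (Fin ρ × Fin e))))
    (n := 2 * ρ * ρ + 2) (by rw [Finset.card_univ, hI]; exact hcount)
  have hdeg := ncard_neighborSet_assemblePlugs h (o := joiningPattern ρ t e)
    (fun s => (ncard_fiber_joiningPattern s).trans hr)
  let G := assemblePlugs P τ (joiningPattern ρ t e)
  let φ := G.overFinIso rfl
  refine ⟨.ofGraph G (assembledEnds w J),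
    ⟨(starFree_of_forall_triangle hdeg (exists_triangle_assemblePlugs h hport ?_)).of_iso φ,
      (isEdgeConnected_assemblePlugs h ht he hr (by omega)).of_iso φ,
      (isRegularGraph_of_ncard hdeg).of_iso φ,
      GraphPair.evenAndFarApart_ofGraph ?_ (assembledEnds_far h hw J),
      GraphPair.not_hasSpanningPathCycleSystem_ofGraph
        (not_hasSpanningPathCycleSystem_assemblePlugs w J (by omega))⟩, ?_⟩
  · rintro ⟨u, j⟩
    exact ⟨.inl (u, ⟨0, ht⟩), (j, true), (j, false), by simp, rfl, rfl⟩
  · rw [card_assembledEnds, hS, hJ]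
    exact ⟨2 * ρ * ρ + 1, by ring⟩
  · let i : ((Fin ρ × Bool) × Fin t) ⊕ (Fin ρ × Fin e) := .inr (⟨0, hρ⟩, ⟨0, by omega⟩)
    refine hn.trans_le (Fintype.card_le_of_injective (fun v => .inr (i, v)) fun u v huv => ?_)
    simpa using huv

theorem proposition1 (r : ℕ) (hr : 4 ≤ r) :
    (Odd r → InfinitelyManyPairs fun p =>
      StarFree r p.G ∧ p.G.IsEdgeConnected (r - 1) ∧ IsRegularGraph r p.G ∧
        p.EvenAndFarApart ∧ ¬ HasSpanningPathCycleSystem p.G (p.W : Set (Fin p.order))) ∧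
    (Even r → InfinitelyManyPairs fun p =>
      StarFree r p.G ∧ p.G.IsEdgeConnected (r - 2) ∧ IsRegularGraph r p.G ∧
        p.EvenAndFarApart ∧ ¬ HasSpanningPathCycleSystem p.G (p.W : Set (Fin p.order))) ∧
    (InfinitelyManyPairs fun p =>
      p.G.IsEdgeConnected r ∧ IsRegularGraph r p.G ∧ p.G.IsBipartite ∧
        p.EvenAndFarApart ∧ ¬ HasSpanningPathCycleSystem p.G (p.W : Set (Fin p.order))) := by
  refine ⟨?_, ?_, infinitelyManyPairs_bipartite r hr⟩
  · -- With `r = 2 * t + 3`, an odd degree leaves `ρ = t + 1` and three joins outside the group.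
    rintro ⟨ρ, rfl⟩
    obtain ⟨t, rfl⟩ : ∃ t, ρ = t + 1 := ⟨ρ - 1, by omega⟩
    rw [Nat.add_sub_cancel]
    refine infinitelyManyPairs_starFree (t := t) (e := 3) (by omega) le_rfl (by omega) (by omega)
      (by ring) (by nlinarith) (· = ·) (fun a => ?_) (.inr (by omega))
    rw [Set.ofPred_eq_eq_singleton', Set.ncard_singleton, add_comm]
  · -- With `r = 2 * ρ + 2`, an even degree leaves two joins outside the group.
    rintro ⟨k, rfl⟩
    obtain ⟨ρ, rfl⟩ : ∃ ρ, k = ρ + 1 := ⟨k - 1, by omega⟩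
    rw [show ρ + 1 + (ρ + 1) - 2 = 2 * ρ by omega]
    let R : Fin ρ × Bool → Fin ρ × Bool → Prop := fun a b => a.1 = b.1
    have : Std.Symm R := ⟨fun _ _ h => h.symm⟩
    have : Std.Refl R := ⟨fun _ => rfl⟩
    refine infinitelyManyPairs_starFree (t := ρ) (e := 2) (by omega) (by omega) (by omega) le_rfl
      (by ring) (by nlinarith) R (fun a => ?_) (.inl fun a => ⟨(a.1, !a.2), ?_, rfl⟩)
    · have : {b | R a b} = {(a.1, true), (a.1, false)} := by
        ext ⟨j, b⟩
        cases b <;> simp [R, eq_comm]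
      rw [this, Set.ncard_pair (by simp)]
      ring
    · intro h
      have := congrArg Prod.snd h
      simp at this
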